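/- **Setting.** Consider the AODV routing protocol modelled in the process algebra AWN. A *network* is an encapsulated parallel composition of finitely many nodes with pairwise distinct addresses. Each node $ip:(\xi,P\,\langle\!\langle\,\zeta,Q):R$ runs a main process $P$ and, in parallel, a message queue $Q$ that can at any time accept an incoming message and passes the messages on to $P$ in first-in-first-out order; $\xi,\zeta$ are the valuations of the data variables and $R$ is the set of addresses in transmission range, which may change arbitrarily by (symmetric) connect and disconnect events. $N\xrightarrow{\ell}N'$ denotes a transition of the AWN operational semantics: messages that are broadcast, groupcast or unicast are received by all intended nodes that are in range of the sender, a unicast to a node out of range fails, and the environment can inject new data packets only. Every assignment, guard evaluation and message transmission of a node is a separate transition; an action whose data expressions are undefined cannot be performed. *Routing tables.* A routing table $rt$ is a set of entries $r=(dip,dsn,dsk,flag,hops,nhip,pre)$ (destination, destination sequence number in $\mathbb N$, sequence-number status $\mathsf{kno}/\mathsf{unk}$, validity $\mathsf{val}/\mathsf{inv}$, hop count in $\mathbb N$, next hop, set of precursors), with at most one entry $\sigma(rt,dip)$ for each destination. $\mathrm{vD}(rt)$ and $\mathrm{iD}(rt)$ are the sets of destinations of valid and invalid entries, and $\mathrm{kD}(rt)=\mathrm{vD}(rt)\cup\mathrm{iD}(rt)$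 is the set of *known destinations*; $\mathrm{sqn}(rt,dip)$ is the sequence number of $\sigma(rt,dip)$ ($0$ if there is no entry), $\mathrm{sqnf}(rt,dip)$ its status ($\mathsf{unk}$ if there is no entry); $\mathrm{nhop}$, $\mathrm{dhops}$, $\mathrm{precs}$ are next hop, hop count, precursors. Let $\mathrm{inc}(n)=n+1$ for $n\ne0$ and $\mathrm{inc}(0)=0$. - $\mathrm{addpreRT}(rt,dip,A)$ adds the set $A$ to the precursors of $\sigma(rt,dip)$ (undefined without such an entry). - $\mathrm{invalidate}(rt,dests)$, for a partial function $dests$ from addresses to sequence numbers, sets the flag of the entry for each $rip\in\mathrm{dom}(dests)$ to $\mathsf{inv}$ and its sequence number to $dests(rip)$. - $\mathrm{update}(rt,r)$ is defined only if $r$ is valid, has sequence number $0$ iff its status is $\mathsf{unk}$, and has hop count $1$ if its status is $\mathsf{unk}$. If $rt$ has no entry for the destination of $r$, then $r$ is added. Otherwise let $s$ be that entry. If $s$ has a smaller sequence number than $r$, or the same one and either a larger hop count or the flag $\mathsf{inv}$, then $s$ is replaced by $r$. Failing this, if the status of $r$ is $\mathsf{unk}$, then $s$ is replaced by $r$ with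 the sequence number of $s$. In all these cases the precursors of $s$ are added to those of $r$. In the remaining case only the precursors of $r$ are added to $s$. *Processes.* Each node maintains its address $ip$, its own sequence number $sn$, its routing table $rt$, the set $rreqs$ of route requests it has seen (pairs of originator and request identifier) and a $store$ holding, per destination, a queue of data packets and a request-required flag. The main process repeatedly does one of the following. - *Receive a message.* For a route request, route reply or route error from sender $sip$, first $rt:=\mathrm{update}(rt,(sip,0,\mathsf{unk},\mathsf{val},1,sip,\emptyset))$. Then the message is handled as follows. - *New packet* $\mathrm{newpkt}(d,dip)$: deliver $d$ if $dip=ip$, otherwise append it to the queue for $dip$ (a new queue has its flag set). - *Packet* $\mathrm{pkt}(d,dip,oip)$: deliver if $dip=ip$; otherwise, if $dip\in\mathrm{vD}(rt)$, unicast it to $\mathrm{nhop}(rt,dip)$, with *link-break handling* for $dip$ if this fails; otherwise, if $dip\in\mathrm{iD}(rt)$, groupcast the error $\{(dip,\mathrm{sqn}(rt,dip))\}$ to $\mathrm{precs}(rt,dip)$. - *Route request* $(hops,rreqid,dip,dsn,dsk,oip,osn,sip)$: ignore it if $(oip,rreqid)\in rreqs$. Otherwise $rt:=\mathrm{update}(rt,(oip,osn,\mathsf{kno},\mathsf{val},hops+1,sip,\emptyset))$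 and $(oip,rreqid)$ is added to $rreqs$. If $dip=ip$: $sn:=\max(sn,dsn)$ and unicast the reply $(0,dip,sn,oip,ip)$ to $\mathrm{nhop}(rt,oip)$. If $dip\ne ip$, $dip\in\mathrm{vD}(rt)$, $dsn\le\mathrm{sqn}(rt,dip)$ and $\mathrm{sqnf}(rt,dip)=\mathsf{kno}$: $rt:=\mathrm{addpreRT}(rt,dip,\{sip\})$, $rt:=\mathrm{addpreRT}(rt,oip,\{\mathrm{nhop}(rt,dip)\})$, and unicast the reply $(\mathrm{dhops}(rt,dip),dip,\mathrm{sqn}(rt,dip),oip,ip)$ to $\mathrm{nhop}(rt,oip)$. Otherwise rebroadcast the request as $(hops+1,rreqid,dip,\max(\mathrm{sqn}(rt,dip),dsn),dsk,oip,osn,ip)$. A failed unicast triggers link-break handling for $oip$. - *Route reply* $(hops,dip,dsn,oip,sip)$: let $r=(dip,dsn,\mathsf{kno},\mathsf{val},hops+1,sip,\emptyset)$; ignore it if $\mathrm{update}(rt,r)=rt$. Otherwise $rt:=\mathrm{update}(rt,r)$ and, if $oip\ne ip$ and $oip\in\mathrm{vD}(rt)$, also $rt:=\mathrm{addpreRT}(rt,dip,\{\mathrm{nhop}(rt,oip)\})$,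 $rt:=\mathrm{addpreRT}(rt,\mathrm{nhop}(rt,dip),\{\mathrm{nhop}(rt,oip)\})$, and unicast the reply $(hops+1,dip,dsn,oip,ip)$ to $\mathrm{nhop}(rt,oip)$, with link-break handling for $oip$ if this fails. - *Route error* $(dests,sip)$: restrict $dests$ to those $(rip,rsn)$ with $rip\in\mathrm{vD}(rt)$, $\mathrm{nhop}(rt,rip)=sip$ and $\mathrm{sqn}(rt,rip)<rsn$, then *invalidate and report*. - *Send a queued packet* to $\mathrm{nhop}(rt,dip)$ for some $dip\in\mathrm{vD}(rt)$ with queued packets; drop it from the queue on success, link-break handling for $dip$ on failure. - *Initiate a route request* for some $dip\notin\mathrm{vD}(rt)$ with queued packets whose flag is set: clear the flag, $sn:=\mathrm{inc}(sn)$, choose a new identifier $rreqid$ (one more than the largest $n$ with $(ip,n)\in rreqs$), add $(ip,rreqid)$ to $rreqs$, and broadcast $(0,rreqid,dip,\mathrm{sqn}(rt,dip),\mathrm{sqnf}(rt,dip),ip,sn,ip)$. *Link-break handling* for $d$ sets $dests:=\{(rip,\mathrm{inc}(\mathrm{sqn}(rt,rip)))\mid rip\in\mathrm{vD}(rt),\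 \mathrm{nhop}(rt,rip)=\mathrm{nhop}(rt,d)\}$ and then invalidates and reports. *Invalidate and report*: $rt:=\mathrm{invalidate}(rt,dests)$, set the request-required flags for all destinations in $dests$, and groupcast to all precursors of destinations in $dests$ an error message with those $(rip,rsn)\in dests$ that have $\mathrm{precs}(rt,rip)\ne\emptyset$. A network is *initial* if at every node the main process is at its start, $sn=1$, $rt=\emptyset$, $rreqs=\emptyset$, the store is empty and the message queue is empty; the ranges $R$ are arbitrary. It is *reachable* if some sequence of transitions leads to it from an initial network. For a node $ip$ of $N$, $\xi_N^{ip}(rt)$ is the value of $rt$ in the main process of that node. *Quality.* The net sequence number of an entry $r$ is $\mathrm{nsqn}(r)=dsn$ if $flag=\mathsf{val}$ or $dsn=0$, and $\mathrm{nsqn}(r)=dsn-1$ otherwise. For entries $r,r'$ with the same destination, $$r\sqsubseteq r'\quad:\Leftrightarrow\quad \mathrm{nsqn}(r)<\mathrm{nsqn}(r')\ \lor\ \bigl(\mathrm{nsqn}(r)=\mathrm{nsqn}(r')\ \land\ hops(r)\ge hops(r')\bigr),$$ and $rt\sqsubseteq_{dip}rt'$ means that $rt$ and $rt'$ both have an entry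 for $dip$ and $\sigma(rt,dip)\sqsubseteq\sigma(rt',dip)$. **Theorem.** Let $N$ be a reachable network of the AODV model, let $N\xrightarrow{\ell}N'$ be a transition, let $ip$ be a node of $N$ and let $dip$ be any address. Then $\xi_N^{ip}(rt)$ and $\xi_{N'}^{ip}(rt)$ are defined, and if $dip\in\mathrm{kD}(\xi_N^{ip}(rt))$, then $$dip\in\mathrm{kD}(\xi_{N'}^{ip}(rt))\qquad\text{and}\qquad \xi_N^{ip}(rt)\ \sqsubseteq_{dip}\ \xi_{N'}^{ip}(rt).$$ -/

import Mathlib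

/-!
The process algebra AWN (Algebra for Wireless Networks), instantiated with the data structure of the
AODV routing protocol; the AODV processes; reachable networks; the quality preorder.

Everything is parametrised by the type `IP` of node identifiers and the type `DATA` of application
layer data. Partial functions are functions into `Option`.
-/

namespace AODV

/-! ### Data structure -/

/-- Sequence-number-status flag: known / unknown. -/
inductive SqnStatus where
  | kno
  | unk

/-- Validity of a route. -/
inductive Flag where
  | val
  | inval

/-- Request-required flag: `noreq` (no new route request is needed) / `req` (one is needed). -/
inductive ReqFlag where
  | noreq
  | req

/-- Incrementing a sequence number; the unknown sequence number `0` is left alone. -/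
def inc (n : ℕ) : ℕ := if n ≠ 0 then n + 1 else n

/-- Partial functions from destinations to sequence numbers; `(rip, rsn) ∈ dests` is
`dests rip = some rsn`. -/
abbrev Dests (IP : Type) : Type := IP → Option ℕ

/-- Routing table entries. -/
@[ext]
structure Route (IP : Type) where
  dip : IP
  dsn : ℕ
  dsk : SqnStatus
  flag : Flag
  hops : ℕ
  nhip : IP
  pre : Set IP

/-- Routing tables: sets of entries in which distinct entries have distinct destinations. -/
structure RT (IP : Type) where
  entries : Set (Route IP)
  unique : ∀ r ∈ entries, ∀ s ∈ entries, r ≠ s → r.dip ≠ s.dip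

/-- Adding precursors to an entry. -/
def Route.addpre {IP : Type} (r : Route IP) (npre : Set IP) : Route IP :=
  { r with pre := r.pre ∪ npre }

namespace RT

variable {IP : Type}

/-- The empty routing table. -/
def empty : RT IP := ⟨∅, by simp⟩

open Classical in
/-- The entry for `dip`, if there is one. -/
noncomputable def selroute (rt : RT IP) (dip : IP) : Option (Route IP) :=
  if h : ∃ r ∈ rt.entries, r.dip = dip then some h.choose else none

/-- Destination sequence number; `0` if there is no entry. -/
noncomputable def sqn (rt : RT IP) (dip : IP) : ℕ :=
  match rt.selroute dip with
  | some r => r.dsn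
  | none => 0

/-- Sequence-number-status flag; `unk` if there is no entry. -/
noncomputable def sqnf (rt : RT IP) (dip : IP) : SqnStatus :=
  match rt.selroute dip with
  | some r => r.dsk
  | none => .unk

/-- Hop count (partial). -/
noncomputable def dhops (rt : RT IP) (dip : IP) : Option ℕ := (rt.selroute dip).map Route.hops

/-- Next hop (partial). -/
noncomputable def nhop (rt : RT IP) (dip : IP) : Option IP := (rt.selroute dip).map Route.nhip

/-- Precursors (partial). -/
noncomputable def precs (rt : RT IP) (dip : IP) : Option (Set IP) :=
  (rt.selroute dip).map Route.pre

/-- Destinations of valid routes. -/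
def vD (rt : RT IP) : Set IP := {dip | ∃ r ∈ rt.entries, r.dip = dip ∧ r.flag = .val}

/-- Destinations of invalid routes. -/
def iD (rt : RT IP) : Set IP := {dip | ∃ r ∈ rt.entries, r.dip = dip ∧ r.flag = .inval}

/-- Known destinations. -/
def kD (rt : RT IP) : Set IP := rt.vD ∪ rt.iD

/-- `(rt - {s}) ∪ {r}`, where `s` is the entry of `rt` for the destination of `r` (if any). -/
def put (rt : RT IP) (r : Route IP) : RT IP where
  entries := {s | s ∈ rt.entries ∧ s.dip ≠ r.dip} ∪ {r}
  unique := by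
    rintro a (⟨ha, ha'⟩ | rfl) b (⟨hb, hb'⟩ | rfl) hab
    · exact rt.unique a ha b hb hab
    · exact ha'
    · exact fun h => hb' h.symm
    · exact absurd rfl hab

/-- Adding precursors to the entry for `dip`; defined only if there is such an entry. -/
noncomputable def addpreRT (rt : RT IP) (dip : IP) (npre : Set IP) : Option (RT IP) :=
  (rt.selroute dip).map fun r => rt.put (r.addpre npre)

open Classical in
/-- Updating a routing table with a new entry `r`. Defined only if `r` is valid, has sequence
number `0` exactly when its sequence number is unknown, and is a one-hop route in that case. -/
noncomputable def update (rt : RT IP) (r : Route IP) : Option (RT IP) :=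
  if r.flag = .val ∧ (r.dsn = 0 ↔ r.dsk = .unk) ∧ (r.dsk = .unk → r.hops = 1) then
    match rt.selroute r.dip with
    | none => some (rt.put r)
    | some s =>
      if s.dsn < r.dsn then some (rt.put (r.addpre s.pre))
      else if s.dsn = r.dsn ∧ s.hops > r.hops then some (rt.put (r.addpre s.pre))
      else if s.dsn = r.dsn ∧ s.flag = .inval then some (rt.put (r.addpre s.pre))
      else if r.dsk = .unk then some (rt.put { r.addpre s.pre with dsn := s.dsn })
      else some (rt.put (s.addpre r.pre))
  else none

/-- Invalidating the entries for the destinations in `dests`; the sequence numbers are copied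
from `dests`. -/
def invalidate (rt : RT IP) (dests : Dests IP) : RT IP where
  entries := {r | r ∈ rt.entries ∧ dests r.dip = none} ∪
    {r' | ∃ r ∈ rt.entries, ∃ rsn, dests r.dip = some rsn ∧
      r' = { r with dsn := rsn, flag := .inval }}
  unique := by
    have key : ∀ r ∈ rt.entries, ∀ s ∈ rt.entries, r.dip = s.dip → r = s := by
      intro r hr s hs h
      by_contra hne
      exact rt.unique r hr s hs hne h
    rintro a (⟨ha, ha'⟩ | ⟨a', ha, n, ha', rfl⟩) b (⟨hb, hb'⟩ | ⟨b', hb, m, hb', rfl⟩) hab h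
    · exact hab (key a ha b hb h)
    · simp only at h
      simp [h, hb'] at ha'
    · simp only at h
      simp [← h, ha'] at hb'
    · simp only at h
      obtain rfl := key a' ha b' hb h
      rw [ha'] at hb'
      obtain rfl := Option.some.inj hb'
      exact hab rfl

open Classical in
/-- `{(rip, inc(sqn(rt, rip))) | rip ∈ vD(rt) ∧ nhop(rt, rip) = nhop(rt, d)}`. -/
noncomputable def brokenVia (rt : RT IP) (d : IP) : Dests IP := fun rip =>
  if rip ∈ rt.vD ∧ ∃ n, rt.nhop rip = some n ∧ rt.nhop d = some n then some (inc (rt.sqn rip))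
  else none

/-- `⋃ {precs(rt, rip) | (rip, *) ∈ dests}`. -/
noncomputable def precsOf (rt : RT IP) (dests : Dests IP) : Set IP :=
  {x | ∃ rip rsn pre, dests rip = some rsn ∧ rt.precs rip = some pre ∧ x ∈ pre}

open Classical in
/-- `{(rip, rsn) | (rip, rsn) ∈ dests ∧ precs(rt, rip) ≠ ∅}`. -/
noncomputable def withPrecs (rt : RT IP) (dests : Dests IP) : Dests IP := fun rip =>
  if ∃ pre, rt.precs rip = some pre ∧ pre ≠ ∅ then dests rip else none

open Classical in
/-- `{(rip, rsn) | (rip, rsn) ∈ dests ∧ rip ∈ vD(rt) ∧ nhop(rt, rip) = sip ∧ sqn(rt, rip) < rsn}`. -/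
noncomputable def affectedBy (rt : RT IP) (dests : Dests IP) (sip : IP) : Dests IP := fun rip =>
  if ∃ rsn, dests rip = some rsn ∧ rip ∈ rt.vD ∧ rt.nhop rip = some sip ∧ rt.sqn rip < rsn
  then dests rip else none

end RT

/-- One queue of data packets, for the destination `dip`; the head of the list is the oldest. -/
structure QEntry (IP DATA : Type) where
  dip : IP
  flag : ReqFlag
  queue : List DATA

/-- Stores of queued data packets: at most one queue for each destination. -/
structure Store (IP DATA : Type) where
  entries : Set (QEntry IP DATA)
  unique : ∀ a ∈ entries, ∀ b ∈ entries, a.dip = b.dip → a = b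

namespace Store

variable {IP DATA : Type}

/-- The empty store. -/
def empty : Store IP DATA := ⟨∅, by simp⟩

open Classical in
/-- The entry for `dip`, if there is one. -/
noncomputable def sel (st : Store IP DATA) (dip : IP) : Option (QEntry IP DATA) :=
  if h : ∃ a ∈ st.entries, a.dip = dip then some h.choose else none

/-- The queue for `dip`; empty if there is no entry. -/
noncomputable def selqueue (st : Store IP DATA) (dip : IP) : List DATA :=
  match st.sel dip with
  | some a => a.queue
  | none => []

/-- The request-required flag for `dip` (partial). -/
noncomputable def reqFlag (st : Store IP DATA) (dip : IP) : Option ReqFlag :=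
  (st.sel dip).map QEntry.flag

/-- Destinations with queued packets. -/
def qD (st : Store IP DATA) : Set IP := {dip | ∃ a ∈ st.entries, a.dip = dip}

/-- Removing the entry for `dip`. -/
def erase (st : Store IP DATA) (dip : IP) : Store IP DATA where
  entries := {a | a ∈ st.entries ∧ a.dip ≠ dip}
  unique := fun a ha b hb h => st.unique a ha.1 b hb.1 h

/-- Replacing the entry for the destination of `a` (if any) by `a`. -/
def put (st : Store IP DATA) (a : QEntry IP DATA) : Store IP DATA where
  entries := {b | b ∈ st.entries ∧ b.dip ≠ a.dip} ∪ {a}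
  unique := by
    rintro x (⟨hx, hx'⟩ | rfl) y (⟨hy, hy'⟩ | rfl) h
    · exact st.unique x hx y hy h
    · exact absurd h hx'
    · exact absurd h.symm hy'
    · rfl

/-- Appending a data packet to the queue for `dip`. -/
noncomputable def add (d : DATA) (dip : IP) (st : Store IP DATA) : Store IP DATA :=
  match st.sel dip with
  | none => st.put ⟨dip, .req, [d]⟩
  | some a => st.put ⟨dip, a.flag, a.queue ++ [d]⟩

/-- Dropping the oldest packet for `dip`; undefined if there is none. -/
noncomputable def drop (dip : IP) (st : Store IP DATA) : Option (Store IP DATA) :=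
  match st.sel dip with
  | none => none
  | some a =>
    match a.queue with
    | [] => none
    | [_] => some (st.erase dip)
    | _ :: d :: q => some (st.put ⟨dip, a.flag, d :: q⟩)

/-- Setting the request-required flag for `dip` to `noreq`. -/
noncomputable def unsetRRF (st : Store IP DATA) (dip : IP) : Store IP DATA :=
  match st.sel dip with
  | none => st
  | some a => st.put { a with flag := .noreq }

/-- Setting the request-required flag to `req` for all destinations in `dests`. -/
def setRRF (st : Store IP DATA) (dests : Dests IP) : Store IP DATA where
  entries := {a | a ∈ st.entries ∧ dests a.dip = none} ∪
    {a' | ∃ a ∈ st.entries, dests a.dip ≠ none ∧ a' = { a with flag := .req }}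
  unique := by
    rintro a (⟨ha, ha'⟩ | ⟨a', ha, ha', rfl⟩) b (⟨hb, hb'⟩ | ⟨b', hb, hb', rfl⟩) h
    · exact st.unique a ha b hb h
    · simp only at h
      exact absurd (h ▸ ha') hb'
    · simp only at h
      exact absurd (h ▸ hb') ha'
    · simp only at h
      rw [st.unique a' ha b' hb h]

end Store

/-- The set of route requests seen so far, as pairs (originator, request identifier). -/
abbrev Rreqs (IP : Type) : Type := Set (IP × ℕ)

/-- A fresh request identifier: `max {n | (ip, n) ∈ rreqs} + 1`, the maximum of `∅` being `0`. -/
noncomputable def nrreqid {IP : Type} (rreqs : Rreqs IP) (ip : IP) : ℕ :=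
  sSup {n | (ip, n) ∈ rreqs} + 1

/-- Messages. -/
inductive Msg (IP DATA : Type) where
  | rreq (hops rreqid : ℕ) (dip : IP) (dsn : ℕ) (dsk : SqnStatus) (oip : IP) (osn : ℕ) (sip : IP)
  | rrep (hops : ℕ) (dip : IP) (dsn : ℕ) (oip sip : IP)
  | rerr (dests : Dests IP) (sip : IP)
  | newpkt (d : DATA) (dip : IP)
  | pkt (d : DATA) (dip oip : IP)

/-! ### Variables, valuations, expressions and formulas -/

/-- The data variables. -/
inductive Var where
  | ip | sn | rt | rreqs | store
  | msg | msgs | data | hops | rreqid | dip | dsn | dsk | oip | osn | sip | dests | pre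
  deriving DecidableEq

/-- The types of the data variables. -/
abbrev Ty (IP DATA : Type) : Var → Type
  | .ip => IP
  | .sn => ℕ
  | .rt => RT IP
  | .rreqs => Rreqs IP
  | .store => Store IP DATA
  | .msg => Msg IP DATA
  | .msgs => List (Msg IP DATA)
  | .data => DATA
  | .hops => ℕ
  | .rreqid => ℕ
  | .dip => IP
  | .dsn => ℕ
  | .dsk => SqnStatus
  | .oip => IP
  | .osn => ℕ
  | .sip => IP
  | .dests => Dests IP
  | .pre => Set IP

/-- Valuations: partial assignments of values to variables. -/
abbrev Valuation (IP DATA : Type) : Type := (v : Var) → Option (Ty IP DATA v)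

/-- Data expressions of type `T`, given by their (partial) evaluation under a valuation. -/
abbrev Expr (IP DATA T : Type) : Type := Valuation IP DATA → Option T

/-- Data formulas, given by their free variables and the valuations under which they hold. -/
structure Formula (IP DATA : Type) where
  fv : Set Var
  holds : Valuation IP DATA → Prop

/-- `ξ[v := x]`. -/
def Valuation.set {IP DATA : Type} (ξ : Valuation IP DATA) (v : Var) (x : Ty IP DATA v) :
    Valuation IP DATA :=
  Function.update ξ v (some x)

/-- `ζ` extends `ξ` by values for precisely those free variables of `φ` that `ξ` does not evaluate,
in such a way that `φ` holds. -/
def Formula.Extends {IP DATA : Type} (φ : Formula IP DATA) (ξ ζ : Valuation IP DATA) : Prop :=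
  (∀ v, ξ v ≠ none → ζ v = ξ v) ∧ (∀ v, ξ v = none → (ζ v ≠ none ↔ v ∈ φ.fv)) ∧ φ.holds ζ

/-! ### Sequential processes -/

/-- The process names. -/
inductive PName where
  | aodv | newpkt | pkt | rreq | rrep | rerr | qmsg

/-- The variables that a process name takes as parameters. -/
def PName.params : PName → List Var
  | .aodv => [.ip, .sn, .rt, .rreqs, .store]
  | .newpkt => [.data, .dip, .ip, .sn, .rt, .rreqs, .store]
  | .pkt => [.data, .dip, .oip, .ip, .sn, .rt, .rreqs, .store]
  | .rreq => [.hops, .rreqid, .dip, .dsn, .dsk, .oip, .osn, .sip, .ip, .sn, .rt, .rreqs, .store]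
  | .rrep => [.hops, .dip, .dsn, .oip, .sip, .ip, .sn, .rt, .rreqs, .store]
  | .rerr => [.dests, .sip, .ip, .sn, .rt, .rreqs, .store]
  | .qmsg => [.msgs]

/-- Tuples of data expressions for a list of parameters. -/
def Args (IP DATA : Type) : List Var → Type
  | [] => Unit
  | v :: vs => Expr IP DATA (Ty IP DATA v) × Args IP DATA vs

/-- The valuation `∅[varᵢ := ξ(expᵢ)]ᵢ`; undefined if one of the `ξ(expᵢ)` is. -/
def Args.bind {IP DATA : Type} :
    (vs : List Var) → Args IP DATA vs → Valuation IP DATA → Option (Valuation IP DATA)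
  | [], _, _ => some fun _ => none
  | v :: vs, (e, es), ξ => do
    let x ← e ξ
    let ζ ← Args.bind vs es ξ
    return ζ.set v x

/-- Sequential process expressions. The variable bound by `receive` is `msg`, the only variable
whose type is that of messages. -/
inductive Proc (IP DATA : Type) where
  | call (X : PName) (es : Args IP DATA X.params)
  | guard (φ : Formula IP DATA) (p : Proc IP DATA)
  | assign (v : Var) (e : Expr IP DATA (Ty IP DATA v)) (p : Proc IP DATA)
  | choice (p q : Proc IP DATA)
  | broadcast (ms : Expr IP DATA (Msg IP DATA)) (p : Proc IP DATA)
  | groupcast (dests : Expr IP DATA (Set IP)) (ms : Expr IP DATA (Msg IP DATA)) (p : Proc IP DATA)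
  | send (ms : Expr IP DATA (Msg IP DATA)) (p : Proc IP DATA)
  | deliver (d : Expr IP DATA DATA) (p : Proc IP DATA)
  | receive (p : Proc IP DATA)
  | unicast (dest : Expr IP DATA IP) (ms : Expr IP DATA (Msg IP DATA)) (p q : Proc IP DATA)

/-- Actions of sequential and parallel processes. -/
inductive Act (IP DATA : Type) where
  | broadcast (m : Msg IP DATA)
  | groupcast (D : Set IP) (m : Msg IP DATA)
  | unicast (dip : IP) (m : Msg IP DATA)
  | notUnicast (dip : IP) (m : Msg IP DATA)
  | send (m : Msg IP DATA)
  | deliver (d : DATA)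
  | receive (m : Msg IP DATA)
  | tau

section Processes

variable {IP DATA : Type}

/-- A variable, as a data expression. -/
def var (v : Var) : Expr IP DATA (Ty IP DATA v) := fun ξ => ξ v

/-- `AODV(ip, sn, rt, rreqs, store)` -/
def callAODV : Proc IP DATA :=
  .call .aodv (var .ip, var .sn, var .rt, var .rreqs, var .store, ())

/-- `NEWPKT(data, dip, ip, sn, rt, rreqs, store)` -/
def callNEWPKT : Proc IP DATA :=
  .call .newpkt (var .data, var .dip, var .ip, var .sn, var .rt, var .rreqs, var .store, ())

/-- `PKT(data, dip, oip, ip, sn, rt, rreqs, store)` -/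
def callPKT : Proc IP DATA :=
  .call .pkt
    (var .data, var .dip, var .oip, var .ip, var .sn, var .rt, var .rreqs, var .store, ())

/-- `RREQ(hops, rreqid, dip, dsn, dsk, oip, osn, sip, ip, sn, rt, rreqs, store)` -/
def callRREQ : Proc IP DATA :=
  .call .rreq
    (var .hops, var .rreqid, var .dip, var .dsn, var .dsk, var .oip, var .osn, var .sip,
      var .ip, var .sn, var .rt, var .rreqs, var .store, ())

/-- `RREP(hops, dip, dsn, oip, sip, ip, sn, rt, rreqs, store)` -/
def callRREP : Proc IP DATA :=
  .call .rrep
    (var .hops, var .dip, var .dsn, var .oip, var .sip,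
      var .ip, var .sn, var .rt, var .rreqs, var .store, ())

/-- `RERR(dests, sip, ip, sn, rt, rreqs, store)` -/
def callRERR : Proc IP DATA :=
  .call .rerr (var .dests, var .sip, var .ip, var .sn, var .rt, var .rreqs, var .store, ())

/-- `QMSG(e)` -/
def callQMSG (e : Expr IP DATA (List (Msg IP DATA))) : Proc IP DATA :=
  .call .qmsg (e, ())

/-- `nhop(rt, d)` -/
noncomputable def nhopE (d : Expr IP DATA IP) : Expr IP DATA IP := fun ξ => do
  let rt ← ξ .rt
  let d ← d ξ
  rt.nhop d

/-- `rerr(dests, ip)` -/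
def rerrE : Expr IP DATA (Msg IP DATA) := fun ξ => do
  let dests ← ξ .dests
  let ip ← ξ .ip
  return .rerr dests ip

/-- The common tail of the error handling: invalidate the routes in `dests`, set the
request-required flags, and send an error message to the affected precursors. -/
noncomputable def invalidateAndReport : Proc IP DATA :=
  -- rt := invalidate(rt, dests)
  .assign .rt (fun ξ => do
    let rt ← ξ .rt
    let dests ← ξ .dests
    return rt.invalidate dests) <|
  -- store := setRRF(store, dests)
  .assign .store (fun ξ => do
    let store ← ξ .store
    let dests ← ξ .dests
    return store.setRRF dests) <|
  -- pre := ⋃ {precs(rt, rip) | (rip, *) ∈ dests}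
  .assign .pre (fun ξ => do
    let rt ← ξ .rt
    let dests ← ξ .dests
    return rt.precsOf dests) <|
  -- dests := {(rip, rsn) | (rip, rsn) ∈ dests ∧ precs(rt, rip) ≠ ∅}
  .assign .dests (fun ξ => do
    let rt ← ξ .rt
    let dests ← ξ .dests
    return rt.withPrecs dests) <|
  .groupcast (var .pre) rerrE callAODV

/-- Error handling after a failed unicast to `nhop(rt, d)`. -/
noncomputable def linkBreak (d : Expr IP DATA IP) : Proc IP DATA :=
  -- dests := {(rip, inc(sqn(rt, rip))) | rip ∈ vD(rt) ∧ nhop(rt, rip) = nhop(rt, d)}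
  .assign .dests (fun ξ => do
    let rt ← ξ .rt
    let d ← d ξ
    return rt.brokenVia d)
  invalidateAndReport

/-- `rt := update(rt, (sip, 0, unk, val, 1, sip, ∅))`, then `p`. -/
noncomputable def updateSender (p : Proc IP DATA) : Proc IP DATA :=
  .assign .rt (fun ξ => do
    let rt ← ξ .rt
    let sip ← ξ .sip
    rt.update ⟨sip, 0, .unk, .val, 1, sip, ∅⟩) p

/-- The basic routine. -/
noncomputable def bodyAODV : Proc IP DATA :=
  .choice
    (.receive <|
      .choice
        -- [msg = newpkt(data, dip)]
        (.guard ⟨{.msg, .data, .dip}, fun ξ => ∃ d dip, ξ .data = some d ∧ ξ .dip = some dip ∧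
            ξ .msg = some (.newpkt d dip)⟩
          callNEWPKT) <|
      .choice
        -- [msg = pkt(data, dip, oip)]
        (.guard ⟨{.msg, .data, .dip, .oip}, fun ξ => ∃ d dip oip, ξ .data = some d ∧
            ξ .dip = some dip ∧ ξ .oip = some oip ∧ ξ .msg = some (.pkt d dip oip)⟩
          callPKT) <|
      .choice
        -- [msg = rreq(hops, rreqid, dip, dsn, dsk, oip, osn, sip)]
        (.guard ⟨{.msg, .hops, .rreqid, .dip, .dsn, .dsk, .oip, .osn, .sip}, fun ξ =>
            ∃ hops rreqid dip dsn dsk oip osn sip, ξ .hops = some hops ∧ ξ .rreqid = some rreqid ∧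
              ξ .dip = some dip ∧ ξ .dsn = some dsn ∧ ξ .dsk = some dsk ∧ ξ .oip = some oip ∧
              ξ .osn = some osn ∧ ξ .sip = some sip ∧
              ξ .msg = some (.rreq hops rreqid dip dsn dsk oip osn sip)⟩ <|
          updateSender callRREQ) <|
      .choice
        -- [msg = rrep(hops, dip, dsn, oip, sip)]
        (.guard ⟨{.msg, .hops, .dip, .dsn, .oip, .sip}, fun ξ =>
            ∃ hops dip dsn oip sip, ξ .hops = some hops ∧ ξ .dip = some dip ∧ ξ .dsn = some dsn ∧
              ξ .oip = some oip ∧ ξ .sip = some sip ∧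
              ξ .msg = some (.rrep hops dip dsn oip sip)⟩ <|
          updateSender callRREP)
        -- [msg = rerr(dests, sip)]
        (.guard ⟨{.msg, .dests, .sip}, fun ξ => ∃ dests sip, ξ .dests = some dests ∧
            ξ .sip = some sip ∧ ξ .msg = some (.rerr dests sip)⟩ <|
          updateSender callRERR)) <|
  .choice
    -- [dip ∈ qD(store) ∩ vD(rt)]
    (.guard ⟨{.dip, .store, .rt}, fun ξ => ∃ dip store rt, ξ .dip = some dip ∧
        ξ .store = some store ∧ ξ .rt = some rt ∧ dip ∈ store.qD ∩ rt.vD⟩ <|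
      -- data := head(selqueue(store, dip))
      .assign .data (fun ξ => do
        let store ← ξ .store
        let dip ← ξ .dip
        (store.selqueue dip).head?) <|
      .unicast (nhopE (var .dip))
        (fun ξ => do
          let d ← ξ .data
          let dip ← ξ .dip
          let ip ← ξ .ip
          return .pkt d dip ip)
        -- store := drop(dip, store)
        (.assign .store (fun ξ => do
            let dip ← ξ .dip
            let store ← ξ .store
            store.drop dip)
          callAODV)
        (linkBreak (var .dip)))
    -- [dip ∈ qD(store) - vD(rt) ∧ reqFlag(store, dip) = req]
    (.guard ⟨{.dip, .store, .rt}, fun ξ => ∃ dip store rt, ξ .dip = some dip ∧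
        ξ .store = some store ∧ ξ .rt = some rt ∧ dip ∈ store.qD \ rt.vD ∧
        store.reqFlag dip = some .req⟩ <|
      -- store := unsetRRF(store, dip)
      .assign .store (fun ξ => do
        let store ← ξ .store
        let dip ← ξ .dip
        return store.unsetRRF dip) <|
      -- sn := inc(sn)
      .assign .sn (fun ξ => do
        let sn ← ξ .sn
        return inc sn) <|
      -- rreqid := nrreqid(rreqs, ip)
      .assign .rreqid (fun ξ => do
        let rreqs ← ξ .rreqs
        let ip ← ξ .ip
        return nrreqid rreqs ip) <|
      -- rreqs := rreqs ∪ {(ip, rreqid)}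
      .assign .rreqs (fun ξ => do
        let rreqs ← ξ .rreqs
        let ip ← ξ .ip
        let rreqid ← ξ .rreqid
        return rreqs ∪ {(ip, rreqid)}) <|
      -- broadcast(rreq(0, rreqid, dip, sqn(rt, dip), sqnf(rt, dip), ip, sn, ip))
      .broadcast (fun ξ => do
          let rreqid ← ξ .rreqid
          let dip ← ξ .dip
          let rt ← ξ .rt
          let ip ← ξ .ip
          let sn ← ξ .sn
          return .rreq 0 rreqid dip (rt.sqn dip) (rt.sqnf dip) ip sn ip)
        callAODV)

/-- `[dip = ip]` -/
def dipEqIp : Formula IP DATA :=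
  ⟨{.dip, .ip}, fun ξ => ∃ dip ip, ξ .dip = some dip ∧ ξ .ip = some ip ∧ dip = ip⟩

/-- `[dip ≠ ip]` -/
def dipNeIp : Formula IP DATA :=
  ⟨{.dip, .ip}, fun ξ => ∃ dip ip, ξ .dip = some dip ∧ ξ .ip = some ip ∧ dip ≠ ip⟩

/-- Handling a newly injected data packet. -/
noncomputable def bodyNEWPKT : Proc IP DATA :=
  .choice
    (.guard dipEqIp <| .deliver (var .data) callAODV)
    (.guard dipNeIp <|
      -- store := add(data, dip, store)
      .assign .store (fun ξ => do
          let d ← ξ .data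
          let dip ← ξ .dip
          let store ← ξ .store
          return store.add d dip)
        callAODV)

/-- Handling a received data packet. -/
noncomputable def bodyPKT : Proc IP DATA :=
  .choice
    (.guard dipEqIp <| .deliver (var .data) callAODV)
    (.guard dipNeIp <|
      .choice
        -- [dip ∈ vD(rt)]
        (.guard ⟨{.dip, .rt}, fun ξ => ∃ dip rt, ξ .dip = some dip ∧ ξ .rt = some rt ∧
            dip ∈ rt.vD⟩ <|
          .unicast (nhopE (var .dip))
            (fun ξ => do
              let d ← ξ .data
              let dip ← ξ .dip
              let oip ← ξ .oip
              return .pkt d dip oip)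
            callAODV
            (linkBreak (var .dip)))
        -- [dip ∉ vD(rt)]
        (.guard ⟨{.dip, .rt}, fun ξ => ∃ dip rt, ξ .dip = some dip ∧ ξ .rt = some rt ∧
            dip ∉ rt.vD⟩ <|
          .choice
            -- [dip ∈ iD(rt)]
            (.guard ⟨{.dip, .rt}, fun ξ => ∃ dip rt, ξ .dip = some dip ∧ ξ .rt = some rt ∧
                dip ∈ rt.iD⟩ <|
              -- groupcast(precs(rt, dip), rerr({(dip, sqn(rt, dip))}, ip))
              .groupcast
                (fun ξ => do
                  let rt ← ξ .rt
                  let dip ← ξ .dip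
                  rt.precs dip)
                (fun ξ => do
                  let rt ← ξ .rt
                  let dip ← ξ .dip
                  let ip ← ξ .ip
                  return .rerr (open Classical in Function.update (fun _ => none) dip
                    (some (rt.sqn dip))) ip)
                callAODV)
            -- [dip ∉ iD(rt)]
            (.guard ⟨{.dip, .rt}, fun ξ => ∃ dip rt, ξ .dip = some dip ∧ ξ .rt = some rt ∧
                dip ∉ rt.iD⟩
              callAODV)))

/-- Handling a route request. -/
noncomputable def bodyRREQ : Proc IP DATA :=
  .choice
    -- [(oip, rreqid) ∈ rreqs]
    (.guard ⟨{.oip, .rreqid, .rreqs}, fun ξ => ∃ oip rreqid rreqs, ξ .oip = some oip ∧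
        ξ .rreqid = some rreqid ∧ ξ .rreqs = some rreqs ∧ (oip, rreqid) ∈ rreqs⟩
      callAODV)
    -- [(oip, rreqid) ∉ rreqs]
    (.guard ⟨{.oip, .rreqid, .rreqs}, fun ξ => ∃ oip rreqid rreqs, ξ .oip = some oip ∧
        ξ .rreqid = some rreqid ∧ ξ .rreqs = some rreqs ∧ (oip, rreqid) ∉ rreqs⟩ <|
      -- rt := update(rt, (oip, osn, kno, val, hops + 1, sip, ∅))
      .assign .rt (fun ξ => do
        let rt ← ξ .rt
        let oip ← ξ .oip
        let osn ← ξ .osn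
        let hops ← ξ .hops
        let sip ← ξ .sip
        rt.update ⟨oip, osn, .kno, .val, hops + 1, sip, ∅⟩) <|
      -- rreqs := rreqs ∪ {(oip, rreqid)}
      .assign .rreqs (fun ξ => do
        let rreqs ← ξ .rreqs
        let oip ← ξ .oip
        let rreqid ← ξ .rreqid
        return rreqs ∪ {(oip, rreqid)}) <|
      .choice
        (.guard dipEqIp <|
          -- sn := max(sn, dsn)
          .assign .sn (fun ξ => do
            let sn ← ξ .sn
            let dsn ← ξ .dsn
            return max sn dsn) <|
          -- unicast(nhop(rt, oip), rrep(0, dip, sn, oip, ip))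
          .unicast (nhopE (var .oip))
            (fun ξ => do
              let dip ← ξ .dip
              let sn ← ξ .sn
              let oip ← ξ .oip
              let ip ← ξ .ip
              return .rrep 0 dip sn oip ip)
            callAODV
            (linkBreak (var .oip)))
        (.guard dipNeIp <|
          .choice
            -- [dip ∈ vD(rt) ∧ dsn ≤ sqn(rt, dip) ∧ sqnf(rt, dip) = kno]
            (.guard ⟨{.dip, .rt, .dsn}, fun ξ => ∃ dip rt dsn, ξ .dip = some dip ∧
                ξ .rt = some rt ∧ ξ .dsn = some dsn ∧
                dip ∈ rt.vD ∧ dsn ≤ rt.sqn dip ∧ rt.sqnf dip = .kno⟩ <|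
              -- rt := addpreRT(rt, dip, {sip})
              .assign .rt (fun ξ => do
                let rt ← ξ .rt
                let dip ← ξ .dip
                let sip ← ξ .sip
                rt.addpreRT dip {sip}) <|
              -- rt := addpreRT(rt, oip, {nhop(rt, dip)})
              .assign .rt (fun ξ => do
                let rt ← ξ .rt
                let oip ← ξ .oip
                let dip ← ξ .dip
                let nh ← rt.nhop dip
                rt.addpreRT oip {nh}) <|
              -- unicast(nhop(rt, oip), rrep(dhops(rt, dip), dip, sqn(rt, dip), oip, ip))
              .unicast (nhopE (var .oip))
                (fun ξ => do
                  let rt ← ξ .rt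
                  let dip ← ξ .dip
                  let oip ← ξ .oip
                  let ip ← ξ .ip
                  let hops ← rt.dhops dip
                  return .rrep hops dip (rt.sqn dip) oip ip)
                callAODV
                (linkBreak (var .oip)))
            -- [dip ∉ vD(rt) ∨ sqn(rt, dip) < dsn ∨ sqnf(rt, dip) = unk]
            (.guard ⟨{.dip, .rt, .dsn}, fun ξ => ∃ dip rt dsn, ξ .dip = some dip ∧
                ξ .rt = some rt ∧ ξ .dsn = some dsn ∧
                (dip ∉ rt.vD ∨ rt.sqn dip < dsn ∨ rt.sqnf dip = .unk)⟩ <|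
              -- broadcast(rreq(hops + 1, rreqid, dip, max(sqn(rt, dip), dsn), dsk, oip, osn, ip))
              .broadcast (fun ξ => do
                  let hops ← ξ .hops
                  let rreqid ← ξ .rreqid
                  let dip ← ξ .dip
                  let rt ← ξ .rt
                  let dsn ← ξ .dsn
                  let dsk ← ξ .dsk
                  let oip ← ξ .oip
                  let osn ← ξ .osn
                  let ip ← ξ .ip
                  return .rreq (hops + 1) rreqid dip (max (rt.sqn dip) dsn) dsk oip osn ip)
                callAODV)))

/-- `update(rt, (dip, dsn, kno, val, hops + 1, sip, ∅))` -/
noncomputable def rrepUpdate : Expr IP DATA (RT IP) := fun ξ => do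
  let rt ← ξ .rt
  let dip ← ξ .dip
  let dsn ← ξ .dsn
  let hops ← ξ .hops
  let sip ← ξ .sip
  rt.update ⟨dip, dsn, .kno, .val, hops + 1, sip, ∅⟩

/-- Handling a route reply. -/
noncomputable def bodyRREP : Proc IP DATA :=
  .choice
    -- [rt ≠ update(rt, (dip, dsn, kno, val, hops + 1, sip, ∅))]
    (.guard ⟨{.rt, .dip, .dsn, .hops, .sip}, fun ξ => ∃ rt rt', ξ .rt = some rt ∧
        rrepUpdate ξ = some rt' ∧ rt ≠ rt'⟩ <|
      -- rt := update(rt, (dip, dsn, kno, val, hops + 1, sip, ∅))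
      .assign .rt rrepUpdate <|
      .choice
        -- [oip = ip]
        (.guard ⟨{.oip, .ip}, fun ξ => ∃ oip ip, ξ .oip = some oip ∧ ξ .ip = some ip ∧ oip = ip⟩
          callAODV)
        -- [oip ≠ ip]
        (.guard ⟨{.oip, .ip}, fun ξ => ∃ oip ip, ξ .oip = some oip ∧ ξ .ip = some ip ∧
            oip ≠ ip⟩ <|
          .choice
            -- [oip ∈ vD(rt)]
            (.guard ⟨{.oip, .rt}, fun ξ => ∃ oip rt, ξ .oip = some oip ∧ ξ .rt = some rt ∧
                oip ∈ rt.vD⟩ <|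
              -- rt := addpreRT(rt, dip, {nhop(rt, oip)})
              .assign .rt (fun ξ => do
                let rt ← ξ .rt
                let dip ← ξ .dip
                let oip ← ξ .oip
                let nh ← rt.nhop oip
                rt.addpreRT dip {nh}) <|
              -- rt := addpreRT(rt, nhop(rt, dip), {nhop(rt, oip)})
              .assign .rt (fun ξ => do
                let rt ← ξ .rt
                let dip ← ξ .dip
                let oip ← ξ .oip
                let nd ← rt.nhop dip
                let nh ← rt.nhop oip
                rt.addpreRT nd {nh}) <|
              -- unicast(nhop(rt, oip), rrep(hops + 1, dip, dsn, oip, ip))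
              .unicast (nhopE (var .oip))
                (fun ξ => do
                  let hops ← ξ .hops
                  let dip ← ξ .dip
                  let dsn ← ξ .dsn
                  let oip ← ξ .oip
                  let ip ← ξ .ip
                  return .rrep (hops + 1) dip dsn oip ip)
                callAODV
                (linkBreak (var .oip)))
            -- [oip ∉ vD(rt)]
            (.guard ⟨{.oip, .rt}, fun ξ => ∃ oip rt, ξ .oip = some oip ∧ ξ .rt = some rt ∧
                oip ∉ rt.vD⟩
              callAODV)))
    -- [rt = update(rt, (dip, dsn, kno, val, hops + 1, sip, ∅))]
    (.guard ⟨{.rt, .dip, .dsn, .hops, .sip}, fun ξ => ∃ rt rt', ξ .rt = some rt ∧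
        rrepUpdate ξ = some rt' ∧ rt = rt'⟩
      callAODV)

/-- Handling a route error message. -/
noncomputable def bodyRERR : Proc IP DATA :=
  -- dests := {(rip, rsn) | (rip, rsn) ∈ dests ∧ rip ∈ vD(rt) ∧ nhop(rt, rip) = sip ∧
  --   sqn(rt, rip) < rsn}
  .assign .dests (fun ξ => do
    let rt ← ξ .rt
    let dests ← ξ .dests
    let sip ← ξ .sip
    return rt.affectedBy dests sip)
  invalidateAndReport

/-- `receive(msg) . QMSG(append(msg, msgs))` -/
def enqueue : Proc IP DATA :=
  .receive <| callQMSG fun ξ => do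
    let msg ← ξ .msg
    let msgs ← ξ .msgs
    return msgs ++ [msg]

/-- The message queue. -/
def bodyQMSG : Proc IP DATA :=
  .choice enqueue <|
    -- [msgs ≠ []]
    .guard ⟨{.msgs}, fun ξ => ∃ msgs, ξ .msgs = some msgs ∧ msgs ≠ []⟩ <|
      .choice
        -- send(head(msgs)) . QMSG(tail(msgs))
        (.send
          (fun ξ => do
            let msgs ← ξ .msgs
            msgs.head?) <|
          callQMSG fun ξ => do
            let msgs ← ξ .msgs
            msgs.tail?)
        enqueue

/-- The right-hand sides of the defining equations of the process names. -/
noncomputable def body : PName → Proc IP DATA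
  | .aodv => bodyAODV
  | .newpkt => bodyNEWPKT
  | .pkt => bodyPKT
  | .rreq => bodyRREQ
  | .rrep => bodyRREP
  | .rerr => bodyRERR
  | .qmsg => bodyQMSG

end Processes

/-- Structural operational semantics of sequential processes: `ξ, p —a→ ζ, p'`. -/
inductive SeqStep {IP DATA : Type} :
    Valuation IP DATA → Proc IP DATA → Act IP DATA → Valuation IP DATA → Proc IP DATA → Prop
  | broadcast {ξ ms p m} : ms ξ = some m →
      SeqStep ξ (.broadcast ms p) (.broadcast m) ξ p
  | groupcast {ξ ds ms p D m} : ds ξ = some D → ms ξ = some m →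
      SeqStep ξ (.groupcast ds ms p) (.groupcast D m) ξ p
  | unicast {ξ dest ms p q dip m} : dest ξ = some dip → ms ξ = some m →
      SeqStep ξ (.unicast dest ms p q) (.unicast dip m) ξ p
  | notUnicast {ξ dest ms p q dip m} : dest ξ = some dip → ms ξ = some m →
      SeqStep ξ (.unicast dest ms p q) (.notUnicast dip m) ξ q
  | send {ξ ms p m} : ms ξ = some m →
      SeqStep ξ (.send ms p) (.send m) ξ p
  | deliver {ξ e p d} : e ξ = some d →
      SeqStep ξ (.deliver e p) (.deliver d) ξ p
  | receive {ξ p} (m : Msg IP DATA) :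
      SeqStep ξ (.receive p) (.receive m) (ξ.set .msg m) p
  | assign {ξ v e p x} : e ξ = some x →
      SeqStep ξ (.assign v e p) .tau (ξ.set v x) p
  | call {ξ X es ξ' a ζ p'} : Args.bind X.params es ξ = some ξ' → SeqStep ξ' (body X) a ζ p' →
      SeqStep ξ (.call X es) a ζ p'
  | choiceLeft {ξ p q a ζ p'} : SeqStep ξ p a ζ p' → SeqStep ξ (.choice p q) a ζ p'
  | choiceRight {ξ p q a ζ q'} : SeqStep ξ q a ζ q' → SeqStep ξ (.choice p q) a ζ q'
  | guard {ξ φ p ζ} : φ.Extends ξ ζ → SeqStep ξ (.guard φ p) .tau ζ p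

/-! ### Parallel processes, nodes and networks -/

/-- Parallel process expressions: `ξ, p` and `P ⟪ Q`. -/
inductive Par (IP DATA : Type) where
  | seq (ξ : Valuation IP DATA) (p : Proc IP DATA)
  | par (P Q : Par IP DATA)

/-- Structural operational semantics of parallel processes. -/
inductive ParStep {IP DATA : Type} : Par IP DATA → Act IP DATA → Par IP DATA → Prop
  | seq {ξ p a ζ p'} : SeqStep ξ p a ζ p' → ParStep (.seq ξ p) a (.seq ζ p')
  | left {P a P' Q} : ParStep P a P' → (∀ m, a ≠ .receive m) →
      ParStep (.par P Q) a (.par P' Q)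
  | right {P Q a Q'} : ParStep Q a Q' → (∀ m, a ≠ .send m) →
      ParStep (.par P Q) a (.par P Q')
  | comm {P P' Q Q' m} : ParStep P (.receive m) P' → ParStep Q (.send m) Q' →
      ParStep (.par P Q) .tau (.par P' Q')

/-- Partial networks: parallel compositions of node expressions `ip : P : R`. -/
inductive PNet (IP DATA : Type) where
  | node (ip : IP) (P : Par IP DATA) (R : Set IP)
  | par (M N : PNet IP DATA)

/-- Transition labels of nodes and partial networks: `R : *cast(m)`, `H ¬ K : arrive(m)`,
`connect(a, b)`, `disconnect(a, b)`, `ip : deliver(d)` and `τ`. -/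
inductive NAct (IP DATA : Type) where
  | starcast (R : Set IP) (m : Msg IP DATA)
  | arrive (H K : Set IP) (m : Msg IP DATA)
  | connect (a b : IP)
  | disconnect (a b : IP)
  | deliver (ip : IP) (d : DATA)
  | tau

/-- Structural operational semantics of node expressions and partial networks. -/
inductive PNetStep {IP DATA : Type} : PNet IP DATA → NAct IP DATA → PNet IP DATA → Prop
  -- node expressions
  | broadcast {ip P R m P'} : ParStep P (.broadcast m) P' →
      PNetStep (.node ip P R) (.starcast R m) (.node ip P' R)
  | groupcast {ip P R D m P'} : ParStep P (.groupcast D m) P' →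
      PNetStep (.node ip P R) (.starcast (R ∩ D) m) (.node ip P' R)
  | unicast {ip P R dip m P'} : ParStep P (.unicast dip m) P' → dip ∈ R →
      PNetStep (.node ip P R) (.starcast {dip} m) (.node ip P' R)
  | notUnicast {ip P R dip m P'} : ParStep P (.notUnicast dip m) P' → dip ∉ R →
      PNetStep (.node ip P R) .tau (.node ip P' R)
  | deliver {ip P R d P'} : ParStep P (.deliver d) P' →
      PNetStep (.node ip P R) (.deliver ip d) (.node ip P' R)
  | receive {ip P R m P'} : ParStep P (.receive m) P' →
      PNetStep (.node ip P R) (.arrive {ip} ∅ m) (.node ip P' R)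
  | tau {ip P R P'} : ParStep P .tau P' →
      PNetStep (.node ip P R) .tau (.node ip P' R)
  | ignore {ip P R m} :
      PNetStep (.node ip P R) (.arrive ∅ {ip} m) (.node ip P R)
  | connectFrom {ip P R ip'} :
      PNetStep (.node ip P R) (.connect ip ip') (.node ip P (R ∪ {ip'}))
  | connectTo {ip P R ip'} :
      PNetStep (.node ip P R) (.connect ip' ip) (.node ip P (R ∪ {ip'}))
  | connectOther {ip P R ip' ip''} : ip ∉ ({ip', ip''} : Set IP) →
      PNetStep (.node ip P R) (.connect ip' ip'') (.node ip P R)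
  | disconnectFrom {ip P R ip'} :
      PNetStep (.node ip P R) (.disconnect ip ip') (.node ip P (R \ {ip'}))
  | disconnectTo {ip P R ip'} :
      PNetStep (.node ip P R) (.disconnect ip' ip) (.node ip P (R \ {ip'}))
  | disconnectOther {ip P R ip' ip''} : ip ∉ ({ip', ip''} : Set IP) →
      PNetStep (.node ip P R) (.disconnect ip' ip'') (.node ip P R)
  -- parallel compositions of nodes
  | castLeft {M N M' N' R m H K} : PNetStep M (.starcast R m) M' → PNetStep N (.arrive H K m) N' →
      H ⊆ R → K ∩ R = ∅ → PNetStep (.par M N) (.starcast R m) (.par M' N')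
  | castRight {M N M' N' R m H K} : PNetStep M (.arrive H K m) M' → PNetStep N (.starcast R m) N' →
      H ⊆ R → K ∩ R = ∅ → PNetStep (.par M N) (.starcast R m) (.par M' N')
  | arrive {M N M' N' m H K H' K'} : PNetStep M (.arrive H K m) M' →
      PNetStep N (.arrive H' K' m) N' →
      PNetStep (.par M N) (.arrive (H ∪ H') (K ∪ K') m) (.par M' N')
  | deliverLeft {M N M' ip d} : PNetStep M (.deliver ip d) M' →
      PNetStep (.par M N) (.deliver ip d) (.par M' N)
  | deliverRight {M N N' ip d} : PNetStep N (.deliver ip d) N' →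
      PNetStep (.par M N) (.deliver ip d) (.par M N')
  | tauLeft {M N M'} : PNetStep M .tau M' → PNetStep (.par M N) .tau (.par M' N)
  | tauRight {M N N'} : PNetStep N .tau N' → PNetStep (.par M N) .tau (.par M N')
  | connect {M N M' N' a b} : PNetStep M (.connect a b) M' → PNetStep N (.connect a b) N' →
      PNetStep (.par M N) (.connect a b) (.par M' N')
  | disconnect {M N M' N' a b} : PNetStep M (.disconnect a b) M' →
      PNetStep N (.disconnect a b) N' → PNetStep (.par M N) (.disconnect a b) (.par M' N')

/-- Complete (encapsulated) networks `[M]`. -/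
inductive Net (IP DATA : Type) where
  | encap (M : PNet IP DATA)

/-- Transition labels of complete networks. -/
inductive Label (IP DATA : Type) where
  | connect (a b : IP)
  | disconnect (a b : IP)
  | newpkt (ip : IP) (d : DATA) (dip : IP)
  | deliver (ip : IP) (d : DATA)
  | tau

/-- Structural operational semantics of complete networks: `N —ℓ→ N'`. -/
inductive NetStep {IP DATA : Type} : Net IP DATA → Label IP DATA → Net IP DATA → Prop
  | connect {M M' a b} : PNetStep M (.connect a b) M' →
      NetStep (.encap M) (.connect a b) (.encap M')
  | disconnect {M M' a b} : PNetStep M (.disconnect a b) M' →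
      NetStep (.encap M) (.disconnect a b) (.encap M')
  | cast {M M' R m} : PNetStep M (.starcast R m) M' →
      NetStep (.encap M) .tau (.encap M')
  | tau {M M'} : PNetStep M .tau M' →
      NetStep (.encap M) .tau (.encap M')
  | deliver {M M' ip d} : PNetStep M (.deliver ip d) M' →
      NetStep (.encap M) (.deliver ip d) (.encap M')
  | newpkt {M M' ip K d dip} : PNetStep M (.arrive {ip} K (.newpkt d dip)) M' →
      NetStep (.encap M) (.newpkt ip d dip) (.encap M')

/-! ### Initial and reachable networks, projections -/

/-- The process initially running on node `ip`: `(ξ, AODV(ip, sn, rt, rreqs, store)) ⟪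
(ζ, QMSG(msgs))`, where `ξ` and `ζ` assign the initial values. -/
def Par.IsInitial {IP DATA : Type} (ip : IP) (P : Par IP DATA) : Prop :=
  ∃ ξ ζ : Valuation IP DATA,
    P = .par (.seq ξ callAODV) (.seq ζ (callQMSG (var .msgs))) ∧
    ξ .ip = some ip ∧ ξ .sn = some 1 ∧ ξ .rt = some RT.empty ∧ ξ .rreqs = some ∅ ∧
    ξ .store = some Store.empty ∧ ζ .msgs = some []

/-- All nodes of a partial network run their initial process. -/
def PNet.NodesInitial {IP DATA : Type} : PNet IP DATA → Prop
  | .node ip P _ => P.IsInitial ip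
  | .par M N => M.NodesInitial ∧ N.NodesInitial

/-- The addresses of the nodes of a partial network. -/
def PNet.addrs {IP DATA : Type} : PNet IP DATA → List IP
  | .node ip _ _ => [ip]
  | .par M N => M.addrs ++ N.addrs

/-- The addresses of the nodes of a network. -/
def Net.addrs {IP DATA : Type} : Net IP DATA → List IP
  | .encap M => M.addrs

/-- Initial networks: finitely many nodes with pairwise distinct addresses and arbitrary ranges,
each running its initial process. -/
def Net.IsInitial {IP DATA : Type} : Net IP DATA → Prop
  | .encap M => M.NodesInitial ∧ M.addrs.Nodup

/-- Networks that can be reached from an initial network. -/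
def Net.Reachable {IP DATA : Type} (N : Net IP DATA) : Prop :=
  ∃ N₀ : Net IP DATA, N₀.IsInitial ∧
    Relation.ReflTransGen (fun A B => ∃ ℓ, NetStep A ℓ B) N₀ N

/-- The valuation `ξ` of a parallel process of the form `(ξ, p) ⟪ Q`. -/
def Par.mainVal {IP DATA : Type} : Par IP DATA → Option (Valuation IP DATA)
  | .par (.seq ξ _) _ => some ξ
  | _ => none

open Classical in
/-- The valuation `ξ` if `ip : (ξ, p) ⟪ Q : R` is a node expression of the partial network. -/
noncomputable def PNet.mainVal {IP DATA : Type} :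
    PNet IP DATA → IP → Option (Valuation IP DATA)
  | .node ip' P _, ip => if ip' = ip then P.mainVal else none
  | .par M N, ip => (M.mainVal ip).or (N.mainVal ip)

/-- The current routing table of node `ip` in the network `N`: the value of `rt` under the valuation
of the main process of that node. -/
noncomputable def Net.rtOf {IP DATA : Type} : Net IP DATA → IP → Option (RT IP)
  | .encap M, ip => (M.mainVal ip).bind fun ξ => ξ .rt

/-! ### Quality of routing tables -/

open Classical in
/-- The net sequence number of an entry. -/
noncomputable def Route.nsqn {IP : Type} (r : Route IP) : ℕ :=
  if r.flag = .val ∨ r.dsn = 0 then r.dsn else r.dsn - 1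

/-- The quality preorder on entries (for the same destination). -/
def Route.QualityLE {IP : Type} (r r' : Route IP) : Prop :=
  r.nsqn < r'.nsqn ∨ (r.nsqn = r'.nsqn ∧ r.hops ≥ r'.hops)

/-- The quality preorder with respect to `dip` on routing tables that have an entry for `dip`. -/
def RT.QualityLE {IP : Type} (dip : IP) (rt rt' : RT IP) : Prop :=
  ∃ r r', rt.selroute dip = some r ∧ rt'.selroute dip = some r' ∧ r.QualityLE r'

end AODV

/-!
Everything happens locally at one node: a transition changes the routing table of a node only
through an assignment to `rt`, that is, through `update`, `addpreRT` or `invalidate`.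

* `addpreRT` leaves net sequence numbers and hop counts alone.
* `update` replaces an entry only by one of at least the same quality. The delicate case is the
  one-hop route to the sender of a message, which inherits the old sequence number: it is at least
  as good as the old entry because every entry of a routing table has a positive hop count
  (`RT.HopsPos`), a property that is itself preserved by all assignments.
* `invalidate rt dests` is harmless provided that `nsqn ≤ rsn - 1` whenever `(rip, rsn) ∈ dests`,
  since `rsn - 1` is the net sequence number of the new, invalid entry. Both ways of computing
  `dests` (`brokenVia` after a link break, `affectedBy` after an error message) guarantee this
  (`RT.Invalidatable`).

The assignment of `dests` and the invalidation are separate transitions, so the last condition has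
to be remembered between them. This is done by `Proc.Safe`, a weakest-precondition style predicate
on pairs of a process expression and a valuation, defined by recursion on the process expression:
every assignment met on the way to the next process call evolves the routing table as required.
All bodies of process names of the main process are safe (`safe_body`), and transitions of
sequential processes preserve safety (`SeqStep.evolves`). The rest is lifting this invariant through
parallel processes, nodes and networks (`PNetStep.evolves`).
-/

namespace AODV

/-! ### Routing tables -/

section RoutingTables

variable {IP : Type}

theorem Route.QualityLE.refl (r : Route IP) : r.QualityLE r := Or.inr ⟨rfl, le_rfl⟩

theorem Route.nsqn_le_dsn (r : Route IP) : r.nsqn ≤ r.dsn := by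
  unfold Route.nsqn; split_ifs <;> omega

theorem Route.nsqn_of_val {r : Route IP} (h : r.flag = .val) : r.nsqn = r.dsn := by
  simp [Route.nsqn, h]

theorem Route.nsqn_of_inval {r : Route IP} (h : r.flag = .inval) : r.nsqn = r.dsn - 1 := by
  unfold Route.nsqn; split_ifs <;> simp_all

namespace RT

theorem selroute_eq_some {rt : RT IP} {dip : IP} {r : Route IP} :
    rt.selroute dip = some r ↔ r ∈ rt.entries ∧ r.dip = dip := by
  unfold selroute
  split_ifs with h
  · have hc := h.choose_spec
    rw [Option.some.injEq]
    refine ⟨fun e => e ▸ hc, fun hr => ?_⟩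
    by_contra hne
    exact rt.unique _ hc.1 _ hr.1 hne (hc.2.trans hr.2.symm)
  · simp only [false_iff]
    exact fun hr => h ⟨r, hr⟩

theorem mem_kD {rt : RT IP} {dip : IP} : dip ∈ rt.kD ↔ ∃ r ∈ rt.entries, r.dip = dip := by
  constructor
  · rintro (⟨r, hr, h, -⟩ | ⟨r, hr, h, -⟩) <;> exact ⟨r, hr, h⟩
  · rintro ⟨r, hr, h⟩
    cases hf : r.flag
    · exact Or.inl ⟨r, hr, h, hf⟩
    · exact Or.inr ⟨r, hr, h, hf⟩

/-- All hop counts are positive. -/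
def HopsPos (rt : RT IP) : Prop := ∀ r ∈ rt.entries, 1 ≤ r.hops

/-- Every entry of `rt` has a counterpart of at least the same quality in `rt'`. -/
def Improves (rt rt' : RT IP) : Prop :=
  ∀ r ∈ rt.entries, ∃ r' ∈ rt'.entries, r'.dip = r.dip ∧ r.QualityLE r'

theorem Improves.refl (rt : RT IP) : rt.Improves rt := fun r hr => ⟨r, hr, rfl, .refl r⟩

theorem Improves.kD_and_qualityLE {rt rt' : RT IP} (h : rt.Improves rt') {dip : IP}
    (hd : dip ∈ rt.kD) : dip ∈ rt'.kD ∧ QualityLE dip rt rt' := by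
  obtain ⟨r, hr, rfl⟩ := mem_kD.1 hd
  obtain ⟨r', hr', hdip, hq⟩ := h r hr
  exact ⟨mem_kD.2 ⟨r', hr', hdip⟩, r, r', selroute_eq_some.2 ⟨hr, rfl⟩,
    selroute_eq_some.2 ⟨hr', hdip⟩, hq⟩

/-- Passing from `rt` to `rt'` preserves positivity of hop counts and, given that positivity, loses
no quality. -/
def Evolves (rt rt' : RT IP) : Prop := rt.HopsPos → rt'.HopsPos ∧ rt.Improves rt'

theorem Evolves.refl (rt : RT IP) : rt.Evolves rt := fun h => ⟨h, .refl rt⟩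

theorem evolves_put {rt : RT IP} {r : Route IP}
    (h : rt.HopsPos → 1 ≤ r.hops ∧ ∀ s ∈ rt.entries, s.dip = r.dip → s.QualityLE r) :
    rt.Evolves (rt.put r) := by
  intro hp
  obtain ⟨hr, hq⟩ := h hp
  refine ⟨?_, fun s hs => ?_⟩
  · rintro s (⟨hs, -⟩ | rfl)
    exacts [hp s hs, hr]
  · by_cases hd : s.dip = r.dip
    · exact ⟨r, Or.inr rfl, hd.symm, hq s hs hd⟩
    · exact ⟨s, Or.inl ⟨hs, hd⟩, rfl, .refl s⟩

/-- Putting an entry into a routing table, when its competitor `s` is known. -/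
theorem evolves_put_of_selroute {rt : RT IP} {r s : Route IP}
    (hs : rt.selroute r.dip = some s) (h : 1 ≤ s.hops → 1 ≤ r.hops ∧ s.QualityLE r) :
    rt.Evolves (rt.put r) := by
  refine evolves_put fun hp => ?_
  have h' := h (hp s (selroute_eq_some.1 hs).1)
  refine ⟨h'.1, fun t ht htd => ?_⟩
  have := selroute_eq_some.2 ⟨ht, htd⟩
  rw [hs, Option.some.injEq] at this
  exact this ▸ h'.2

theorem evolves_addpreRT {rt rt' : RT IP} {dip : IP} {A : Set IP}
    (h : rt.addpreRT dip A = some rt') : rt.Evolves rt' := by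
  obtain ⟨r, hr, rfl⟩ := Option.map_eq_some_iff.1 h
  refine evolves_put_of_selroute (s := r) ?_ fun h1 => ⟨h1, .refl r⟩
  obtain ⟨h1, h2⟩ := selroute_eq_some.1 hr
  exact selroute_eq_some.2 ⟨h1, rfl⟩

theorem evolves_update {rt rt' : RT IP} {r : Route IP} (hr : 1 ≤ r.hops)
    (h : rt.update r = some rt') : rt.Evolves rt' := by
  unfold update at h
  by_cases hdef : r.flag = .val ∧ (r.dsn = 0 ↔ r.dsk = .unk) ∧ (r.dsk = .unk → r.hops = 1)
  swap
  · simp [if_neg hdef] at h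
  rw [if_pos hdef] at h
  obtain ⟨hval, hdsn, hunk⟩ := hdef
  have hnr := Route.nsqn_of_val hval
  split at h
  · -- There is no entry for the destination of `r` yet.
    next hs =>
    obtain rfl := Option.some.inj h
    refine evolves_put fun _ => ⟨hr, fun s hsm hsd => ?_⟩
    rw [selroute_eq_some.2 ⟨hsm, hsd⟩] at hs
    cases hs
  · next s hs =>
    have hns := s.nsqn_le_dsn
    split_ifs at h with h1 h2 h3 h4 <;> obtain rfl := Option.some.inj h
    · exact evolves_put_of_selroute (s := s) hs fun _ => ⟨hr, Or.inl (by
        change s.nsqn < r.nsqn; omega)⟩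
    · refine evolves_put_of_selroute (s := s) hs fun _ => ⟨hr, ?_⟩
      change s.nsqn < r.nsqn ∨ s.nsqn = r.nsqn ∧ s.hops ≥ r.hops
      omega
    · refine evolves_put_of_selroute (s := s) hs fun hpos => ⟨hr, ?_⟩
      have hni := Route.nsqn_of_inval h3.2
      change s.nsqn < r.nsqn ∨ s.nsqn = r.nsqn ∧ s.hops ≥ r.hops
      -- With sequence number `0` the route `r` has unknown status, hence a single hop.
      by_cases h0 : r.dsn = 0
      · have := hunk (hdsn.1 h0)
        omega
      · omega
    · -- The new entry keeps the sequence number of `s` and has one hop, at most as many as `s`.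
      refine evolves_put_of_selroute (s := s) hs fun hpos => ⟨hr, ?_⟩
      have hn : ({ r.addpre s.pre with dsn := s.dsn } : Route IP).nsqn = s.dsn :=
        Route.nsqn_of_val hval
      unfold Route.QualityLE
      rw [hn]
      change s.nsqn < s.dsn ∨ s.nsqn = s.dsn ∧ s.hops ≥ r.hops
      have := hunk h4
      omega
    · have hsm := selroute_eq_some.1 hs
      exact evolves_put_of_selroute (s := s) (selroute_eq_some.2 ⟨hsm.1, rfl⟩)
        fun hpos => ⟨hpos, .refl s⟩

/-- Invalidating along `dests` loses no quality: `rsn - 1` is the net sequence number of an invalid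
entry with sequence number `rsn`, also for `rsn = 0` because subtraction is truncated. -/
def Invalidatable (rt : RT IP) (dests : Dests IP) : Prop :=
  ∀ r ∈ rt.entries, ∀ rsn, dests r.dip = some rsn → r.nsqn ≤ rsn - 1

theorem Invalidatable.evolves {rt : RT IP} {dests : Dests IP} (h : rt.Invalidatable dests) :
    rt.Evolves (rt.invalidate dests) := by
  refine fun hp => ⟨?_, fun r hr => ?_⟩
  · rintro r (⟨hr, -⟩ | ⟨s, hs, n, -, rfl⟩)
    exacts [hp r hr, hp s hs]
  · cases hd : dests r.dip with
    | none => exact ⟨r, Or.inl ⟨hr, hd⟩, rfl, .refl r⟩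
    | some n =>
      refine ⟨{ r with dsn := n, flag := .inval }, Or.inr ⟨r, hr, n, hd, rfl⟩, rfl, ?_⟩
      have h1 := h r hr n hd
      have h2 : ({ r with dsn := n, flag := .inval } : Route IP).nsqn = n - 1 :=
        Route.nsqn_of_inval rfl
      unfold Route.QualityLE
      rw [h2]
      change r.nsqn < n - 1 ∨ r.nsqn = n - 1 ∧ r.hops ≥ r.hops
      omega

theorem sqn_of_mem {rt : RT IP} {r : Route IP} (hr : r ∈ rt.entries) : rt.sqn r.dip = r.dsn := by
  simp [sqn, selroute_eq_some.2 ⟨hr, rfl⟩]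

theorem invalidatable_brokenVia (rt : RT IP) (d : IP) : rt.Invalidatable (rt.brokenVia d) := by
  intro r hr n hn
  unfold brokenVia at hn
  split_ifs at hn
  rw [Option.some.injEq, sqn_of_mem hr] at hn
  have := r.nsqn_le_dsn
  unfold inc at hn
  split_ifs at hn <;> omega

theorem invalidatable_affectedBy (rt : RT IP) (dests : Dests IP) (sip : IP) :
    rt.Invalidatable (rt.affectedBy dests sip) := by
  intro r hr n hn
  unfold affectedBy at hn
  split_ifs at hn with h
  obtain ⟨m, hm, -, -, hlt⟩ := h
  obtain rfl := Option.some.inj (hm.symm.trans hn)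
  rw [sqn_of_mem hr] at hlt
  have := r.nsqn_le_dsn
  omega

end RT

end RoutingTables

/-! ### Safe sequential processes -/

section Sequential

variable {IP DATA : Type}

/-- If the routing table is defined under `ξ`, then so it is under `ζ`, and it evolves. -/
def Valuation.Evolves (ξ ζ : Valuation IP DATA) : Prop :=
  ∀ rt, ξ .rt = some rt → ∃ rt', ζ .rt = some rt' ∧ rt.Evolves rt'

theorem Valuation.evolves_of_eq {ξ ζ : Valuation IP DATA} (h : ζ .rt = ξ .rt) : ξ.Evolves ζ :=
  fun rt hrt => ⟨rt, h.trans hrt, .refl rt⟩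

theorem Valuation.set_of_ne (ξ : Valuation IP DATA) {v w : Var} (h : w ≠ v) (x : Ty IP DATA v) :
    ξ.set v x w = ξ w :=
  Function.update_of_ne h _ _

theorem Valuation.set_self (ξ : Valuation IP DATA) (v : Var) (x : Ty IP DATA v) :
    ξ.set v x v = some x :=
  Function.update_self _ _ _

theorem Formula.Extends.evolves {φ : Formula IP DATA} {ξ ζ : Valuation IP DATA}
    (h : φ.Extends ξ ζ) : ξ.Evolves ζ := by
  intro rt hrt
  refine Valuation.evolves_of_eq (h.1 .rt ?_) rt hrt
  rw [hrt]
  exact Option.some_ne_none rt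

/-- A weakest precondition: whatever transitions are taken from `p` under the valuation `ξ` up to
the next process call, each assignment evolves the routing table, and that call is one of the main
process which passes on the routing table unchanged. -/
def Proc.Safe : Proc IP DATA → Valuation IP DATA → Prop
  | .call X es, ξ => X ≠ .qmsg ∧ ∀ ζ, Args.bind X.params es ξ = some ζ → ζ .rt = ξ .rt
  | .guard φ p, ξ => ∀ ζ, φ.Extends ξ ζ → p.Safe ζ
  | .assign v e p, ξ => ∀ x, e ξ = some x → ξ.Evolves (ξ.set v x) ∧ p.Safe (ξ.set v x)
  | .choice p q, ξ => p.Safe ξ ∧ q.Safe ξ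
  | .broadcast _ p, ξ => p.Safe ξ
  | .groupcast _ _ p, ξ => p.Safe ξ
  | .send _ p, ξ => p.Safe ξ
  | .deliver _ p, ξ => p.Safe ξ
  | .receive p, ξ => ∀ m, p.Safe (ξ.set .msg m)
  | .unicast _ _ p q, ξ => p.Safe ξ ∧ q.Safe ξ

/-- Assigning to another variable than `rt` is always safe. -/
theorem Proc.safe_assign_of_ne {v : Var} {e : Expr IP DATA (Ty IP DATA v)} {p : Proc IP DATA}
    {ξ : Valuation IP DATA} (hv : .rt ≠ v) (hp : ∀ x, e ξ = some x → p.Safe (ξ.set v x)) :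
    (Proc.assign v e p).Safe ξ :=
  fun x hx => ⟨Valuation.evolves_of_eq (ξ.set_of_ne hv x), hp x hx⟩

theorem Proc.safe_assign_rt {e : Expr IP DATA (RT IP)} {p : Proc IP DATA} {ξ : Valuation IP DATA}
    (he : ∀ rt x, ξ .rt = some rt → e ξ = some x → rt.Evolves x)
    (hp : ∀ x, e ξ = some x → p.Safe (ξ.set .rt x)) : (Proc.assign .rt e p).Safe ξ :=
  fun x hx => ⟨fun rt hrt => ⟨x, ξ.set_self .rt x, he rt x hrt hx⟩, hp x hx⟩

theorem Args.bind_cons {v : Var} {vs : List Var} {e : Expr IP DATA (Ty IP DATA v)}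
    {es : Args IP DATA vs} {ξ ζ : Valuation IP DATA}
    (h : Args.bind (v :: vs) (e, es) ξ = some ζ) :
    ∃ x ζ', e ξ = some x ∧ Args.bind vs es ξ = some ζ' ∧ ζ = ζ'.set v x := by
  simp only [Args.bind, Option.bind_eq_bind, Option.bind_eq_some_iff, Option.pure_def,
    Option.some.injEq] at h
  obtain ⟨x, hx, ζ', hζ', rfl⟩ := h
  exact ⟨x, ζ', hx, hζ', rfl⟩

theorem Args.bind_cons_rt {vs : List Var} {es : Args IP DATA vs} {ξ ζ : Valuation IP DATA}
    (h : Args.bind (.rt :: vs) (var .rt, es) ξ = some ζ) : ζ .rt = ξ .rt := by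
  obtain ⟨x, ζ', hx, -, rfl⟩ := Args.bind_cons h
  exact (ζ'.set_self .rt x).trans hx.symm

theorem Args.bind_cons_of_ne {v : Var} {vs : List Var} {e : Expr IP DATA (Ty IP DATA v)}
    {es : Args IP DATA vs} {ξ ζ : Valuation IP DATA} {o : Option (RT IP)} (hv : .rt ≠ v)
    (hes : ∀ ζ', Args.bind vs es ξ = some ζ' → ζ' .rt = o)
    (h : Args.bind (v :: vs) (e, es) ξ = some ζ) : ζ .rt = o := by
  obtain ⟨x, ζ', -, hζ', rfl⟩ := Args.bind_cons h
  exact (ζ'.set_of_ne hv x).trans (hes ζ' hζ')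

theorem safe_callAODV (ξ : Valuation IP DATA) : (callAODV : Proc IP DATA).Safe ξ := by
  refine ⟨nofun, ?_⟩
  iterate 2 refine fun ζ => Args.bind_cons_of_ne (by decide) ?_
  exact fun ζ => Args.bind_cons_rt

theorem safe_callNEWPKT (ξ : Valuation IP DATA) : (callNEWPKT : Proc IP DATA).Safe ξ := by
  refine ⟨nofun, ?_⟩
  iterate 4 refine fun ζ => Args.bind_cons_of_ne (by decide) ?_
  exact fun ζ => Args.bind_cons_rt

theorem safe_callPKT (ξ : Valuation IP DATA) : (callPKT : Proc IP DATA).Safe ξ := by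
  refine ⟨nofun, ?_⟩
  iterate 5 refine fun ζ => Args.bind_cons_of_ne (by decide) ?_
  exact fun ζ => Args.bind_cons_rt

theorem safe_callRREQ (ξ : Valuation IP DATA) : (callRREQ : Proc IP DATA).Safe ξ := by
  refine ⟨nofun, ?_⟩
  iterate 10 refine fun ζ => Args.bind_cons_of_ne (by decide) ?_
  exact fun ζ => Args.bind_cons_rt

theorem safe_callRREP (ξ : Valuation IP DATA) : (callRREP : Proc IP DATA).Safe ξ := by
  refine ⟨nofun, ?_⟩
  iterate 7 refine fun ζ => Args.bind_cons_of_ne (by decide) ?_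
  exact fun ζ => Args.bind_cons_rt

theorem safe_callRERR (ξ : Valuation IP DATA) : (callRERR : Proc IP DATA).Safe ξ := by
  refine ⟨nofun, ?_⟩
  iterate 4 refine fun ζ => Args.bind_cons_of_ne (by decide) ?_
  exact fun ζ => Args.bind_cons_rt

/-! ### Safety of the AODV processes -/

theorem safe_invalidateAndReport {ξ : Valuation IP DATA}
    (h : ∀ rt dests, ξ .rt = some rt → ξ .dests = some dests → rt.Invalidatable dests) :
    (invalidateAndReport : Proc IP DATA).Safe ξ := by
  refine Proc.safe_assign_rt (fun rt x hrt hx => ?_) fun _ _ => ?_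
  · simp only [hrt, Option.bind_eq_bind, Option.bind_some, Option.bind_eq_some_iff,
      Option.pure_def, Option.some.injEq] at hx
    obtain ⟨dests, hd, rfl⟩ := hx
    exact (h rt dests hrt hd).evolves
  · iterate 3 refine Proc.safe_assign_of_ne (by decide) fun _ _ => ?_
    exact safe_callAODV _

/-- Computing `dests` from `rt` and then invalidating is safe if the computed `dests` always meet
the condition on net sequence numbers. -/
theorem safe_assign_dests {e : Expr IP DATA (Dests IP)} {ξ : Valuation IP DATA}
    (h : ∀ rt dests, ξ .rt = some rt → e ξ = some dests → rt.Invalidatable dests) :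
    (Proc.assign .dests e invalidateAndReport).Safe ξ := by
  refine Proc.safe_assign_of_ne (by decide) fun x hx => ?_
  refine safe_invalidateAndReport fun rt dests hrt hd => ?_
  rw [ξ.set_of_ne (by decide)] at hrt
  rw [ξ.set_self, Option.some.injEq] at hd
  exact h rt dests hrt (hd ▸ hx)

theorem safe_linkBreak (d : Expr IP DATA IP) (ξ : Valuation IP DATA) : (linkBreak d).Safe ξ := by
  refine safe_assign_dests fun rt dests hrt hd => ?_
  simp only [hrt, Option.bind_eq_bind, Option.bind_some, Option.bind_eq_some_iff,
    Option.pure_def, Option.some.injEq] at hd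
  obtain ⟨a, -, rfl⟩ := hd
  exact rt.invalidatable_brokenVia a

theorem safe_bodyRERR (ξ : Valuation IP DATA) : (bodyRERR : Proc IP DATA).Safe ξ := by
  refine safe_assign_dests fun rt dests hrt hd => ?_
  simp only [hrt, Option.bind_eq_bind, Option.bind_some, Option.bind_eq_some_iff,
    Option.pure_def, Option.some.injEq] at hd
  obtain ⟨ds, -, sip, -, rfl⟩ := hd
  exact rt.invalidatable_affectedBy ds sip

theorem safe_updateSender {p : Proc IP DATA} (hp : ∀ ζ, p.Safe ζ) (ξ : Valuation IP DATA) :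
    (updateSender p).Safe ξ := by
  refine Proc.safe_assign_rt (fun rt x hrt hx => ?_) fun _ _ => hp _
  simp only [hrt, Option.bind_eq_bind, Option.bind_some, Option.bind_eq_some_iff] at hx
  obtain ⟨sip, -, hx⟩ := hx
  exact RT.evolves_update le_rfl hx

theorem safe_bodyAODV (ξ : Valuation IP DATA) : (bodyAODV : Proc IP DATA).Safe ξ := by
  refine ⟨fun m => ⟨fun _ _ => safe_callNEWPKT _, fun _ _ => safe_callPKT _,
    fun _ _ => safe_updateSender safe_callRREQ _, fun _ _ => safe_updateSender safe_callRREP _,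
    fun _ _ => safe_updateSender safe_callRERR _⟩, fun _ _ => ?_, fun _ _ => ?_⟩
  · refine Proc.safe_assign_of_ne (by decide) fun _ _ => ⟨?_, safe_linkBreak _ _⟩
    exact Proc.safe_assign_of_ne (by decide) fun _ _ => safe_callAODV _
  · iterate 4 refine Proc.safe_assign_of_ne (by decide) fun _ _ => ?_
    exact safe_callAODV _

theorem safe_bodyNEWPKT (ξ : Valuation IP DATA) : (bodyNEWPKT : Proc IP DATA).Safe ξ :=
  ⟨fun _ _ => safe_callAODV _,
    fun _ _ => Proc.safe_assign_of_ne (by decide) fun _ _ => safe_callAODV _⟩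

theorem safe_bodyPKT (ξ : Valuation IP DATA) : (bodyPKT : Proc IP DATA).Safe ξ :=
  ⟨fun _ _ => safe_callAODV _, fun _ _ =>
    ⟨fun _ _ => ⟨safe_callAODV _, safe_linkBreak _ _⟩, fun _ _ =>
      ⟨fun _ _ => safe_callAODV _, fun _ _ => safe_callAODV _⟩⟩⟩

theorem safe_bodyRREQ (ξ : Valuation IP DATA) : (bodyRREQ : Proc IP DATA).Safe ξ := by
  refine ⟨fun _ _ => safe_callAODV _, fun ζ _ =>
    Proc.safe_assign_rt (fun rt x hrt hx => ?_) fun _ _ => ?_⟩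
  · simp only [hrt, Option.bind_eq_bind, Option.bind_some, Option.bind_eq_some_iff] at hx
    obtain ⟨oip, -, osn, -, hops, -, sip, -, hx⟩ := hx
    exact RT.evolves_update (Nat.le_add_left 1 hops) hx
  refine Proc.safe_assign_of_ne (by decide) fun _ _ => ⟨fun _ _ => ?_, fun _ _ =>
    ⟨fun ζ _ => ?_, fun _ _ => safe_callAODV _⟩⟩
  · exact Proc.safe_assign_of_ne (by decide) fun _ _ => ⟨safe_callAODV _, safe_linkBreak _ _⟩
  · refine Proc.safe_assign_rt (fun rt x hrt hx => ?_) fun _ _ =>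
      Proc.safe_assign_rt (fun rt x hrt hx => ?_) fun _ _ => ⟨safe_callAODV _, safe_linkBreak _ _⟩
    · simp only [hrt, Option.bind_eq_bind, Option.bind_some, Option.bind_eq_some_iff] at hx
      obtain ⟨dip, -, sip, -, hx⟩ := hx
      exact RT.evolves_addpreRT hx
    · simp only [hrt, Option.bind_eq_bind, Option.bind_some, Option.bind_eq_some_iff] at hx
      obtain ⟨oip, -, dip, -, nh, -, hx⟩ := hx
      exact RT.evolves_addpreRT hx

theorem safe_bodyRREP (ξ : Valuation IP DATA) : (bodyRREP : Proc IP DATA).Safe ξ := by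
  refine ⟨fun ζ _ => Proc.safe_assign_rt (fun rt x hrt hx => ?_) fun _ _ =>
    ⟨fun _ _ => safe_callAODV _, fun _ _ => ⟨fun ζ _ => ?_, fun _ _ => safe_callAODV _⟩⟩,
    fun _ _ => safe_callAODV _⟩
  · simp only [rrepUpdate, hrt, Option.bind_eq_bind, Option.bind_some,
      Option.bind_eq_some_iff] at hx
    obtain ⟨dip, -, dsn, -, hops, -, sip, -, hx⟩ := hx
    exact RT.evolves_update (Nat.le_add_left 1 hops) hx
  · refine Proc.safe_assign_rt (fun rt x hrt hx => ?_) fun _ _ =>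
      Proc.safe_assign_rt (fun rt x hrt hx => ?_) fun _ _ => ⟨safe_callAODV _, safe_linkBreak _ _⟩
    · simp only [hrt, Option.bind_eq_bind, Option.bind_some, Option.bind_eq_some_iff] at hx
      obtain ⟨dip, -, oip, -, nh, -, hx⟩ := hx
      exact RT.evolves_addpreRT hx
    · simp only [hrt, Option.bind_eq_bind, Option.bind_some, Option.bind_eq_some_iff] at hx
      obtain ⟨dip, -, oip, -, nd, -, nh, -, hx⟩ := hx
      exact RT.evolves_addpreRT hx

theorem safe_body {X : PName} (hX : X ≠ .qmsg) (ξ : Valuation IP DATA) :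
    (body X : Proc IP DATA).Safe ξ := by
  cases X
  exacts [safe_bodyAODV ξ, safe_bodyNEWPKT ξ, safe_bodyPKT ξ, safe_bodyRREQ ξ, safe_bodyRREP ξ,
    safe_bodyRERR ξ, absurd rfl hX]

/-- Safety is preserved by transitions, and these evolve the routing table. -/
theorem SeqStep.evolves {ξ ζ : Valuation IP DATA} {p p' : Proc IP DATA} {a : Act IP DATA}
    (h : SeqStep ξ p a ζ p') (hp : p.Safe ξ) : ξ.Evolves ζ ∧ p'.Safe ζ := by
  induction h with
  | broadcast | groupcast | send | deliver => exact ⟨Valuation.evolves_of_eq rfl, hp⟩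
  | unicast => exact ⟨Valuation.evolves_of_eq rfl, hp.1⟩
  | notUnicast => exact ⟨Valuation.evolves_of_eq rfl, hp.2⟩
  | receive m =>
    exact ⟨Valuation.evolves_of_eq (Valuation.set_of_ne (w := .rt) (v := .msg) _ nofun m), hp m⟩
  | assign he => exact hp _ he
  | call hb _ ih =>
    obtain ⟨hev, hsafe⟩ := ih (safe_body hp.1 _)
    exact ⟨fun rt hrt => hev rt ((hp.2 _ hb).trans hrt), hsafe⟩
  | choiceLeft _ ih => exact ih hp.1
  | choiceRight _ ih => exact ih hp.2
  | guard hφ => exact ⟨hφ.evolves, hp _ hφ⟩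

end Sequential

/-! ### Nodes and networks -/

section Networks

variable {IP DATA : Type}

/-- The routing tables under both valuations are defined, and no quality is lost. -/
def Valuation.Improves (ξ ζ : Valuation IP DATA) : Prop :=
  ∃ rt rt', ξ .rt = some rt ∧ ζ .rt = some rt' ∧ rt.Improves rt'

/-- The invariant of the parallel process running on a node: its main process is safe, and its
routing table is defined and has positive hop counts. -/
def Par.Inv (P : Par IP DATA) : Prop :=
  ∃ ξ p Q rt, P = .par (.seq ξ p) Q ∧ ξ .rt = some rt ∧ rt.HopsPos ∧ p.Safe ξ

/-- All nodes of a partial network satisfy the invariant. -/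
def PNet.Inv : PNet IP DATA → Prop
  | .node _ P _ => P.Inv
  | .par M N => M.Inv ∧ N.Inv

theorem Par.IsInitial.inv {ip : IP} {P : Par IP DATA} (h : P.IsInitial ip) : P.Inv := by
  obtain ⟨ξ, ζ, rfl, -, -, hrt, -⟩ := h
  exact ⟨ξ, _, _, _, rfl, hrt, fun r hr => absurd hr (Set.notMem_empty r), safe_callAODV ξ⟩

theorem PNet.NodesInitial.inv {M : PNet IP DATA} (h : M.NodesInitial) : M.Inv := by
  induction M with
  | node ip P R => exact Par.IsInitial.inv h
  | par M N ihM ihN => exact ⟨ihM h.1, ihN h.2⟩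

/-- From `P` to `P'` the invariant is preserved and the main valuation improves. -/
def Par.Evolves (P P' : Par IP DATA) : Prop :=
  P.Inv → P'.Inv ∧ Option.Rel Valuation.Improves P.mainVal P'.mainVal

theorem Par.Evolves.refl (P : Par IP DATA) : P.Evolves P := by
  rintro ⟨ξ, p, Q, rt, rfl, hrt, hpos, hp⟩
  exact ⟨⟨ξ, p, Q, rt, rfl, hrt, hpos, hp⟩, .some ⟨rt, rt, hrt, hrt, .refl rt⟩⟩

theorem ParStep.evolves {P P' : Par IP DATA} {a : Act IP DATA} (h : ParStep P a P') :
    P.Evolves P' := by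
  -- The two rules in which the main process moves differ only in what happens to the queue.
  have main : ∀ {ξ : Valuation IP DATA} {p : Proc IP DATA} {Q Q' S' : Par IP DATA}
      {a : Act IP DATA}, ParStep (.seq ξ p) a S' →
      (Par.par (.seq ξ p) Q).Evolves (.par S' Q') := by
    rintro ξ p Q Q' S' a ⟨hs⟩ ⟨ξ₀, p₀, Q₀, rt, heq, hrt, hpos, hp⟩
    cases heq
    obtain ⟨hev, hsafe⟩ := hs.evolves hp
    obtain ⟨rt', hrt', hev⟩ := hev rt hrt
    obtain ⟨hpos', himp⟩ := hev hpos
    exact ⟨⟨_, _, _, rt', rfl, hrt', hpos', hsafe⟩, .some ⟨rt, rt', hrt, hrt', himp⟩⟩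
  intro hinv
  obtain ⟨ξ, p, Q, rt, rfl, hrt, hpos, hp⟩ := id hinv
  cases h with
  | left hs _ => exact main hs hinv
  | right _ _ => exact ⟨⟨ξ, p, _, rt, rfl, hrt, hpos, hp⟩, .some ⟨rt, rt, hrt, hrt, .refl rt⟩⟩
  | comm hs _ => exact main hs hinv

/-- From `M` to `M'` the invariant is preserved and the main valuation of each node improves. -/
def PNet.Evolves (M M' : PNet IP DATA) : Prop :=
  M.Inv → M'.Inv ∧ ∀ ip, Option.Rel Valuation.Improves (M.mainVal ip) (M'.mainVal ip)

theorem PNet.evolves_node {ip : IP} {P P' : Par IP DATA} {R R' : Set IP} (h : P.Evolves P') :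
    (PNet.node ip P R).Evolves (.node ip P' R') := by
  refine fun hinv => ⟨(h hinv).1, fun ip' => ?_⟩
  unfold PNet.mainVal
  split_ifs
  exacts [(h hinv).2, .none]

theorem PNet.evolves_par {M M' N N' : PNet IP DATA} (hM : M.Evolves M') (hN : N.Evolves N') :
    (PNet.par M N).Evolves (.par M' N') := by
  rintro ⟨hMi, hNi⟩
  refine ⟨⟨(hM hMi).1, (hN hNi).1⟩, fun ip => ?_⟩
  have h1 := (hM hMi).2 ip
  have h2 := (hN hNi).2 ip
  unfold PNet.mainVal
  revert h1
  generalize M.mainVal ip = o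
  generalize M'.mainVal ip = o'
  rintro (h | _)
  exacts [.some h, h2]

theorem PNet.Evolves.refl (M : PNet IP DATA) : M.Evolves M := by
  induction M with
  | node ip P R => exact evolves_node (.refl P)
  | par M N ihM ihN => exact evolves_par ihM ihN

theorem PNetStep.evolves {M M' : PNet IP DATA} {a : NAct IP DATA} (h : PNetStep M a M') :
    M.Evolves M' := by
  induction h with
  | broadcast h | groupcast h | deliver h | receive h | tau h => exact PNet.evolves_node h.evolves
  | unicast h _ | notUnicast h _ => exact PNet.evolves_node h.evolves
  | ignore | connectFrom | connectTo | connectOther | disconnectFrom | disconnectTo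
  | disconnectOther => exact PNet.evolves_node (.refl _)
  | castLeft _ _ _ _ ihM ihN | castRight _ _ _ _ ihM ihN => exact PNet.evolves_par ihM ihN
  | arrive _ _ ihM ihN | connect _ _ ihM ihN | disconnect _ _ ihM ihN =>
    exact PNet.evolves_par ihM ihN
  | deliverLeft _ ih | tauLeft _ ih => exact PNet.evolves_par ih (.refl _)
  | deliverRight _ ih | tauRight _ ih => exact PNet.evolves_par (.refl _) ih

theorem PNet.Inv.mainVal_ne_none {M : PNet IP DATA} (h : M.Inv) {ip : IP} (hip : ip ∈ M.addrs) :
    M.mainVal ip ≠ none := by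
  induction M with
  | node ip' P R =>
    obtain ⟨ξ, p, Q, rt, rfl, -⟩ := h
    simp only [PNet.addrs, List.mem_singleton] at hip
    simp [PNet.mainVal, Par.mainVal, hip]
  | par M N ihM ihN =>
    rcases List.mem_append.1 hip with hip | hip
    · simp [PNet.mainVal, ihM h.1 hip]
    · simp [PNet.mainVal, ihN h.2 hip]

theorem NetStep.evolves {M M' : PNet IP DATA} {ℓ : Label IP DATA}
    (h : NetStep (.encap M) ℓ (.encap M')) : M.Evolves M' := by
  cases h with
  | connect h | disconnect h | cast h | tau h | deliver h | newpkt h => exact h.evolves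

theorem Net.Reachable.inv {M : PNet IP DATA} (h : (Net.encap M).Reachable) : M.Inv := by
  obtain ⟨⟨M₀⟩, h₀, hsteps⟩ := h
  generalize hN : Net.encap M = N at hsteps
  induction hsteps generalizing M with
  | refl =>
    cases hN
    exact h₀.1.inv
  | @tail N _ _ hstep ih =>
    subst hN
    obtain ⟨M₁⟩ := N
    obtain ⟨ℓ, hstep⟩ := hstep
    exact (hstep.evolves (ih rfl)).1

end Networks

end AODV

theorem mainTheorem3 {IP DATA : Type} (N N' : AODV.Net IP DATA) (ℓ : AODV.Label IP DATA)
    (hN : N.Reachable) (hstep : AODV.NetStep N ℓ N') (ip : IP) (hip : ip ∈ N.addrs) :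
    ∃ rt rt' : AODV.RT IP, N.rtOf ip = some rt ∧ N'.rtOf ip = some rt' ∧
      ∀ dip ∈ rt.kD, dip ∈ rt'.kD ∧ AODV.RT.QualityLE dip rt rt' := by
  obtain ⟨M⟩ := N
  obtain ⟨M'⟩ := N'
  have hne := hN.inv.mainVal_ne_none hip
  have hrel := (hstep.evolves hN.inv).2 ip
  change ∃ rt rt' : AODV.RT IP, ((M.mainVal ip).bind fun ξ => ξ .rt) = some rt ∧
    ((M'.mainVal ip).bind fun ξ => ξ .rt) = some rt' ∧ _
  revert hne hrel
  generalize M.mainVal ip = o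
  generalize M'.mainVal ip = o'
  rintro hne (⟨rt, rt', hrt, hrt', himp⟩ | _)
  · exact ⟨rt, rt', hrt, hrt', fun dip hd => himp.kD_and_qualityLE hd⟩
  · exact absurd rfl hne
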